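/- For $1\le p<\infty$ let $\|A\|_p=\operatorname{Tr}(|A|^p)^{1/p}$, $|A|=\sqrt{A^*A}$, be the (unnormalized) Schatten $p$-norm on $M_d(\mathbb C)$, and let $\|A\|_\infty$ be the operator norm. For $1\le p\le\infty$, a group $\Gamma$ is called $\mathscr G_p$-approximated if there are dimensions $d_n\in\mathbb N$ and maps $\varphi_n:\Gamma\to U(d_n)$, $n\in\mathbb N$ (not necessarily homomorphisms), such that $$\lim_{n\to\infty}\|\varphi_n(gh)-\varphi_n(g)\varphi_n(h)\|_p=0\quad\text{for all } g,h\in\Gamma,\qquad \liminf_{n\to\infty}\|\varphi_n(g)-1\|_p>0\quad\text{for all } g\in\Gamma\setminus\{1\}.$$ **Proposition.** Let $\Gamma$ be a finitely generated group with a finite normal subgroup $N$. 1. Let $1\le p\le q\le\infty$ and suppose that $\Gamma/N$ is $\mathscr G_q$-approximated. If $\Gamma$ is $\mathscr G_p$-approximated, then $\Gamma$ is $\mathscr G_q$-approximated. 2. In particular, if $\Gamma/N$ is residually finite, then for all $1\le p\le q\le\infty$: if $\Gamma$ is $\mathscr G_p$-approximated, then $\Gamma$ is $\mathscr G_q$-approximated.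 -/

import Mathlib

open Filter Topology
open scoped ENNReal Matrix

noncomputable section

open scoped MatrixOrder Matrix.Norms.L2Operator in
/-- The (unnormalized) Schatten `p`-norm of a square complex matrix: `Tr(|A|^p)^(1/p)` with
`|A| = √(A* A)` for finite `p`, and the operator norm on Euclidean space for `p = ∞`. -/
def schattenNorm (p : ℝ≥0∞) {d : ℕ} (A : Matrix (Fin d) (Fin d) ℂ) : ℝ :=
  if p = ∞ then ‖A‖
  else (Matrix.trace (CFC.abs A ^ p.toReal)).re ^ (1 / p.toReal)

/-- The distance on `U(d)` induced by the Schatten `p`-norm. -/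
def schattenDist (p : ℝ≥0∞) {d : ℕ} (u v : Matrix.unitaryGroup (Fin d) ℂ) : ℝ :=
  schattenNorm p ((u : Matrix (Fin d) (Fin d) ℂ) - (v : Matrix (Fin d) (Fin d) ℂ))

/-- The maps `φ n : Γ → U(d n)` form an asymptotic homomorphism for the Schatten `p`-norm. -/
def IsAsymptoticHom (p : ℝ≥0∞) {Γ : Type*} [Group Γ] {d : ℕ → ℕ}
    (φ : ∀ n, Γ → Matrix.unitaryGroup (Fin (d n)) ℂ) : Prop :=
  ∀ g h : Γ, Tendsto (fun n => schattenDist p (φ n (g * h)) (φ n g * φ n h)) atTop (𝓝 0)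

/-- The maps `φ n : Γ → U(d n)` asymptotically separate `Γ` for the Schatten `p`-norm. The lower
limit is taken in `[0, ∞]`, since the distances may be unbounded in `n`. -/
def AsymptoticallySeparates (p : ℝ≥0∞) {Γ : Type*} [Group Γ] {d : ℕ → ℕ}
    (φ : ∀ n, Γ → Matrix.unitaryGroup (Fin (d n)) ℂ) : Prop :=
  ∀ g : Γ, g ≠ 1 → 0 < liminf (fun n => ENNReal.ofReal (schattenDist p (φ n g) 1)) atTop

/-- `Γ` is approximated by finite-dimensional unitary groups with respect to the Schatten
`p`-norm. -/
def IsSchattenApproximated (p : ℝ≥0∞) (Γ : Type*) [Group Γ] : Prop :=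
  ∃ (d : ℕ → ℕ) (φ : ∀ n, Γ → Matrix.unitaryGroup (Fin (d n)) ℂ),
    IsAsymptoticHom p φ ∧ AsymptoticallySeparates p φ

end

/-! Let `φ n` approximate `Γ` in the `p`-norm, let `ψ n` approximate `Γ ⧸ N` in the `q`-norm, and
take the direct sum of `φ n` with the pullback of `ψ n`. It is asymptotically multiplicative for `q`
because Schatten norms decrease in the exponent (`schattenNorm_antitone`). Elements outside `N` are
separated by `ψ`.

An element `g` of `N` has finite order `k`. Write `u = φ n g`. If `u` is within `1 / (2k)` of `1` in
operator norm, then `k(u - 1) = (u ^ k - 1) - (u - 1) ∑ (u ^ i - 1)`, where the sum over `i < k` has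
operator norm at most `k / 2`. Hence `‖u - 1‖_p ≤ (2 / k) ‖u ^ k - 1‖_p`, which tends to `0` and
contradicts separation in the `p`-norm. So `u` eventually stays `1 / (2k)` away from `1` in operator
norm, the smallest Schatten norm, and therefore in the `q`-norm.

The second part follows because permutation representations of finite quotients approximate a
countable residually finite group in every Schatten norm.

The norm inequalities rest on a variational formula: `‖A‖_p` is the maximal `ℓ^p` norm of the
diagonal of `X * A * Y` over contractions `X`, `Y`. -/

/-! ### Singular value decomposition. -/

section SingularValues

open scoped ComplexOrder MatrixOrder Matrix.Norms.L2Operator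

/-- A matrix with pairwise orthogonal columns of norms `s i` is a unitary matrix times
`diagonal s`. -/
theorem exists_unitary_mul_diagonal_of_conjTranspose_mul_self {d : ℕ}
    (M : Matrix (Fin d) (Fin d) ℂ) (s : Fin d → ℝ)
    (h : Mᴴ * M = Matrix.diagonal fun i => ((s i : ℂ) ^ 2)) :
    ∃ U : Matrix.unitaryGroup (Fin d) ℂ,
      M = (U : Matrix (Fin d) (Fin d) ℂ) * Matrix.diagonal fun i => (s i : ℂ) := by
  let c : Fin d → EuclideanSpace ℂ (Fin d) := fun i => WithLp.toLp 2 fun j => M j i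
  have hc : ∀ i j, inner ℂ (c i) (c j) = if i = j then ((s i : ℂ) ^ 2) else 0 := by
    intro i j
    have := congrFun (congrFun h i) j
    rw [Matrix.diagonal_apply] at this
    rw [← this]
    simp [c, PiLp.inner_apply, Matrix.mul_apply, mul_comm]
  let v : Fin d → EuclideanSpace ℂ (Fin d) := fun i => ((s i : ℂ)⁻¹) • c i
  have hv : Orthonormal ℂ (({i | s i ≠ 0} : Set (Fin d)).domRestrict v) := by
    rw [orthonormal_iff_ite]
    rintro ⟨i, hi⟩ ⟨j, hj⟩
    have hi' : (s i : ℂ) ≠ 0 := by exact_mod_cast hi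
    simp only [Set.domRestrict_apply, v, inner_smul_left, inner_smul_right, hc, Subtype.mk.injEq]
    split_ifs with hij
    · subst hij
      simp only [map_inv₀, Complex.conj_ofReal]
      field_simp
    · simp
  -- Columns with `s i = 0` vanish, so any completion of the normalized nonzero columns to an
  -- orthonormal basis will do.
  obtain ⟨b, hb⟩ := hv.exists_orthonormalBasis_extension_of_card_eq (by simp)
  refine ⟨⟨(EuclideanSpace.basisFun (Fin d) ℂ).toBasis.toMatrix b,
    (EuclideanSpace.basisFun (Fin d) ℂ).toMatrix_orthonormalBasis_mem_unitary b⟩, ?_⟩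
  ext j i
  rw [Matrix.mul_diagonal]
  simp only [Module.Basis.toMatrix_apply, OrthonormalBasis.coe_toBasis_repr_apply,
    EuclideanSpace.basisFun_repr]
  by_cases hi : s i = 0
  · have h0 : c i = 0 := by
      have := hc i i
      simp only [hi, if_true] at this
      simpa using this
    have : M j i = c i j := rfl
    rw [this, h0, hi]
    simp
  · have hi' : (s i : ℂ) ≠ 0 := by exact_mod_cast hi
    rw [hb i hi]
    simp only [v, c, PiLp.smul_apply, smul_eq_mul]
    field_simp

/-- Singular value decomposition, with the singular values computing the traces of the powers of
`|A|`. -/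
theorem exists_singularValueDecomposition {d : ℕ} (A : Matrix (Fin d) (Fin d) ℂ) :
    ∃ (U V : Matrix.unitaryGroup (Fin d) ℂ) (s : Fin d → ℝ), (∀ i, 0 ≤ s i) ∧
      A = (U : Matrix (Fin d) (Fin d) ℂ) * (Matrix.diagonal fun i => (s i : ℂ)) *
        (V : Matrix (Fin d) (Fin d) ℂ) ∧
      ∀ r : ℝ, (Matrix.trace (CFC.abs A ^ r)).re = ∑ i, s i ^ r := by
  have hpos : 0 ≤ CFC.abs A := CFC.abs_nonneg A
  have hP : (CFC.abs A).IsHermitian := (Matrix.nonneg_iff_posSemidef.1 hpos).isHermitian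
  set W := hP.eigenvectorUnitary with hW
  have hWW : star (W : Matrix (Fin d) (Fin d) ℂ) * W = 1 := by simp
  have hWW' : (W : Matrix (Fin d) (Fin d) ℂ) * star (W : Matrix (Fin d) (Fin d) ℂ) = 1 := by simp
  have hsp := hP.spectral_theorem
  rw [Unitary.conjStarAlgAut_apply] at hsp
  -- `W` diagonalizes `|A|`, hence also `Aᴴ * A = |A|²`, so the columns of `A * W` are orthogonal.
  have hM : (A * (W : Matrix (Fin d) (Fin d) ℂ))ᴴ * (A * (W : Matrix (Fin d) (Fin d) ℂ)) =
      Matrix.diagonal fun i => ((hP.eigenvalues i : ℂ) ^ 2) := by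
    have h1 : Aᴴ * A = CFC.abs A * CFC.abs A := (CFC.abs_mul_abs A).symm
    rw [Matrix.conjTranspose_mul, Matrix.mul_assoc, ← Matrix.mul_assoc Aᴴ, h1,
      ← Matrix.star_eq_conjTranspose]
    have : ∀ D : Matrix (Fin d) (Fin d) ℂ, star (W : Matrix (Fin d) (Fin d) ℂ) *
        ((W : Matrix (Fin d) (Fin d) ℂ) * D * star (W : Matrix (Fin d) (Fin d) ℂ) *
        ((W : Matrix (Fin d) (Fin d) ℂ) * D * star (W : Matrix (Fin d) (Fin d) ℂ)) * W) =
        D * D := by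
      intro D
      calc _ = (star (W : Matrix (Fin d) (Fin d) ℂ) * W) * D *
            (star (W : Matrix (Fin d) (Fin d) ℂ) * W) * D *
            (star (W : Matrix (Fin d) (Fin d) ℂ) * W) := by simp only [Matrix.mul_assoc]
        _ = D * D := by rw [hWW]; simp
    have h2 := this (Matrix.diagonal (RCLike.ofReal ∘ hP.eigenvalues))
    rw [hW, ← hsp] at h2
    rw [h2, Matrix.diagonal_mul_diagonal]
    congr 1
    funext i
    simp [sq]
  obtain ⟨U, hU⟩ := exists_unitary_mul_diagonal_of_conjTranspose_mul_self _ _ hM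
  refine ⟨U, star W, hP.eigenvalues, fun i =>
    (Matrix.nonneg_iff_posSemidef.1 hpos).eigenvalues_nonneg i, ?_, fun r => ?_⟩
  · rw [← hU, Matrix.mul_assoc, Unitary.coe_star, hWW', Matrix.mul_one]
  · rw [CFC.rpow_eq_cfc_real hpos, hP.cfc_eq, Matrix.IsHermitian.cfc,
      Unitary.conjStarAlgAut_apply, Matrix.trace_mul_comm, ← Matrix.mul_assoc, hWW,
      Matrix.one_mul, Matrix.trace_diagonal]
    simp

end SingularValues

/-! ### Schatten norms: variational formula, norm axioms, ideal property, monotonicity in the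
exponent. -/

section SchattenNorm

open scoped Matrix.Norms.L2Operator

theorem Matrix.sum_norm_sq_col_le {m n : ℕ} (X : Matrix (Fin m) (Fin n) ℂ) (k : Fin n) :
    ∑ i, ‖X i k‖ ^ 2 ≤ ‖X‖ ^ 2 := by
  have h := X.l2_opNorm_mulVec (EuclideanSpace.single k 1)
  rw [PiLp.norm_single, norm_one, mul_one] at h
  have h2 := pow_le_pow_left₀ (norm_nonneg _) h 2
  rw [EuclideanSpace.norm_sq_eq] at h2
  simpa using h2

theorem Matrix.sum_norm_sq_row_le {m n : ℕ} (X : Matrix (Fin m) (Fin n) ℂ) (i : Fin m) :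
    ∑ k, ‖X i k‖ ^ 2 ≤ ‖X‖ ^ 2 := by
  simpa [Matrix.l2_opNorm_conjTranspose] using Xᴴ.sum_norm_sq_col_le i

theorem Matrix.norm_entry_le_l2_opNorm {m n : ℕ} (X : Matrix (Fin m) (Fin n) ℂ) (i : Fin m)
    (k : Fin n) : ‖X i k‖ ≤ ‖X‖ :=
  le_of_sq_le_sq ((Finset.single_le_sum (f := fun k => ‖X i k‖ ^ 2) (fun _ _ => sq_nonneg _)
    (Finset.mem_univ k)).trans (X.sum_norm_sq_row_le i)) (norm_nonneg _)

theorem Matrix.l2_opNorm_le_one_of_conjTranspose_mul_self {m n : ℕ}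
    {X : Matrix (Fin m) (Fin n) ℂ} (h : Xᴴ * X = 1) : ‖X‖ ≤ 1 := by
  have h1 := X.l2_opNorm_conjTranspose_mul_self
  -- Equality fails for `n = 0`.
  have h2 : ‖(1 : Matrix (Fin n) (Fin n) ℂ)‖ ≤ 1 := by
    rw [← Matrix.diagonal_one, Matrix.l2_opNorm_diagonal]
    exact (pi_norm_le_iff_of_nonneg zero_le_one).2 fun i => by simp
  rw [h] at h1
  nlinarith [norm_nonneg X]

theorem Matrix.unitaryGroup.l2_opNorm_le_one {d : ℕ} (U : Matrix.unitaryGroup (Fin d) ℂ) :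
    ‖(U : Matrix (Fin d) (Fin d) ℂ)‖ ≤ 1 :=
  Matrix.l2_opNorm_le_one_of_conjTranspose_mul_self
    (by rw [← Matrix.star_eq_conjTranspose]; simp)

/-- Jensen's inequality for powers with weights of total mass at most one. -/
theorem Real.rpow_sum_mul_le_of_sum_le_one {ι : Type*} [Fintype ι] (w s : ι → ℝ)
    (hw : ∀ i, 0 ≤ w i) (hw1 : ∑ i, w i ≤ 1) (hs : ∀ i, 0 ≤ s i) {r : ℝ} (hr : 1 ≤ r) :
    (∑ i, w i * s i) ^ r ≤ ∑ i, w i * s i ^ r := by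
  -- The missing mass is put on an extra point `none` with value `0`.
  have h := Real.rpow_arith_mean_le_arith_mean_rpow Finset.univ
    (fun o : Option ι => o.elim (1 - ∑ i, w i) w) (fun o : Option ι => o.elim 0 s)
    (by rintro (_ | i) _ <;> simp [hw, hw1]) (by simp [Fintype.sum_option])
    (by rintro (_ | i) _ <;> simp [hs]) hr
  simpa [Fintype.sum_option, Real.zero_rpow (by linarith : r ≠ 0)] using h

/-- The diagonal entries of `X * diagonal s * Y`, for contractions `X` and `Y`, have `ℓ^r` norm at
most that of `s`. -/
theorem Matrix.sum_norm_diag_rpow_le {m n : ℕ} {X : Matrix (Fin m) (Fin n) ℂ}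
    {Y : Matrix (Fin n) (Fin m) ℂ} (hX : ‖X‖ ≤ 1) (hY : ‖Y‖ ≤ 1) {s : Fin n → ℝ}
    (hs : ∀ k, 0 ≤ s k) {r : ℝ} (hr : 1 ≤ r) :
    ∑ i, ‖(X * (Matrix.diagonal fun k => (s k : ℂ)) * Y) i i‖ ^ r ≤ ∑ k, s k ^ r := by
  -- By AM-GM these weights dominate `‖X i k‖ * ‖Y k i‖`. Rows and columns of a contraction have
  -- norm at most one, so `w` is doubly substochastic and Jensen applies row by row.
  let w : Fin m → Fin n → ℝ := fun i k => (‖X i k‖ ^ 2 + ‖Y k i‖ ^ 2) / 2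
  have hX2 : ‖X‖ ^ 2 ≤ 1 := pow_le_one₀ (norm_nonneg _) hX
  have hY2 : ‖Y‖ ^ 2 ≤ 1 := pow_le_one₀ (norm_nonneg _) hY
  have hw : ∀ i k, 0 ≤ w i k := fun i k => by positivity
  have hrow : ∀ i, ∑ k, w i k ≤ 1 := fun i => by
    have h1 := X.sum_norm_sq_row_le i
    have h2 := Y.sum_norm_sq_col_le i
    simp only [w, ← Finset.sum_div, Finset.sum_add_distrib]
    linarith
  have hcol : ∀ k, ∑ i, w i k ≤ 1 := fun k => by
    have h1 := X.sum_norm_sq_col_le k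
    have h2 := Y.sum_norm_sq_row_le k
    simp only [w, ← Finset.sum_div, Finset.sum_add_distrib]
    linarith
  have hentry : ∀ i, ‖(X * (Matrix.diagonal fun k => (s k : ℂ)) * Y) i i‖ ≤
      ∑ k, w i k * s k := fun i => by
    rw [Matrix.mul_apply]
    refine (norm_sum_le _ _).trans (Finset.sum_le_sum fun k _ => ?_)
    rw [Matrix.mul_diagonal, norm_mul, norm_mul, Complex.norm_of_nonneg (hs k)]
    have : ‖X i k‖ * ‖Y k i‖ ≤ w i k := by
      simp only [w]
      nlinarith [sq_nonneg (‖X i k‖ - ‖Y k i‖)]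
    calc ‖X i k‖ * s k * ‖Y k i‖ = ‖X i k‖ * ‖Y k i‖ * s k := by ring
      _ ≤ _ := mul_le_mul_of_nonneg_right this (hs k)
  calc ∑ i, ‖(X * (Matrix.diagonal fun k => (s k : ℂ)) * Y) i i‖ ^ r
      ≤ ∑ i, ∑ k, w i k * s k ^ r := Finset.sum_le_sum fun i _ =>
        (Real.rpow_le_rpow (norm_nonneg _) (hentry i) (by linarith)).trans
          (Real.rpow_sum_mul_le_of_sum_le_one (w i) s (hw i) (hrow i) hs hr)
    _ = ∑ k, (∑ i, w i k) * s k ^ r := by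
        rw [Finset.sum_comm]
        simp only [Finset.sum_mul]
    _ ≤ ∑ k, s k ^ r := Finset.sum_le_sum fun k _ =>
        mul_le_of_le_one_left (Real.rpow_nonneg (hs k) r) (hcol k)

theorem schattenNorm_top {d : ℕ} (A : Matrix (Fin d) (Fin d) ℂ) : schattenNorm ∞ A = ‖A‖ := by
  simp [schattenNorm]

/-- A single `s` serves all finite exponents, which makes norms for different `p` comparable. -/
theorem exists_singularValues {d : ℕ} (A : Matrix (Fin d) (Fin d) ℂ) :
    ∃ (U V : Matrix.unitaryGroup (Fin d) ℂ) (s : Fin d → ℝ), (∀ i, 0 ≤ s i) ∧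
      A = (U : Matrix (Fin d) (Fin d) ℂ) * (Matrix.diagonal fun i => (s i : ℂ)) *
        (V : Matrix (Fin d) (Fin d) ℂ) ∧
      ∀ p : ℝ≥0∞, p ≠ ∞ → schattenNorm p A = (∑ i, s i ^ p.toReal) ^ (1 / p.toReal) := by
  obtain ⟨U, V, s, hs, hA, htr⟩ := exists_singularValueDecomposition A
  exact ⟨U, V, s, hs, hA, fun p hp => by rw [schattenNorm, if_neg hp, htr]⟩

variable {p : ℝ≥0∞}

theorem one_le_toReal_of_one_le (hp : 1 ≤ p) (hp' : p ≠ ∞) : 1 ≤ p.toReal := by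
  simpa using ENNReal.toReal_mono hp' hp

theorem schattenNorm_nonneg {d : ℕ} (A : Matrix (Fin d) (Fin d) ℂ) : 0 ≤ schattenNorm p A := by
  by_cases hp : p = ∞
  · subst hp
    rw [schattenNorm_top]
    exact norm_nonneg A
  · obtain ⟨-, -, s, hs, -, h⟩ := exists_singularValues A
    rw [h p hp]
    exact Real.rpow_nonneg (Finset.sum_nonneg fun i _ => Real.rpow_nonneg (hs i) _) _

/-- The `ℓ^p` norm of the diagonal of `X * A * Y`, for contractions `X` and `Y`, is at most the
Schatten norm of `A`. -/
theorem lpNorm_diag_le_schattenNorm {m n : ℕ} (hp : 1 ≤ p) (hp' : p ≠ ∞)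
    {X : Matrix (Fin m) (Fin n) ℂ} {Y : Matrix (Fin n) (Fin m) ℂ} (hX : ‖X‖ ≤ 1) (hY : ‖Y‖ ≤ 1)
    (A : Matrix (Fin n) (Fin n) ℂ) :
    (∑ i, ‖(X * A * Y) i i‖ ^ p.toReal) ^ (1 / p.toReal) ≤ schattenNorm p A := by
  have hr := one_le_toReal_of_one_le hp hp'
  obtain ⟨U, V, s, hs, hA, h⟩ := exists_singularValues A
  rw [h p hp']
  refine Real.rpow_le_rpow (Finset.sum_nonneg fun i _ => Real.rpow_nonneg (norm_nonneg _) _) ?_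
    (by positivity)
  have hXU : ‖X * (U : Matrix (Fin n) (Fin n) ℂ)‖ ≤ 1 := (Matrix.l2_opNorm_mul _ _).trans
    (mul_le_one₀ hX (norm_nonneg _) (Matrix.unitaryGroup.l2_opNorm_le_one U))
  have hVY : ‖(V : Matrix (Fin n) (Fin n) ℂ) * Y‖ ≤ 1 := (Matrix.l2_opNorm_mul _ _).trans
    (mul_le_one₀ (Matrix.unitaryGroup.l2_opNorm_le_one V) (norm_nonneg _) hY)
  have key := Matrix.sum_norm_diag_rpow_le hXU hVY hs hr
  rw [hA]
  simpa only [Matrix.mul_assoc] using key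

/-- The bound of `lpNorm_diag_le_schattenNorm` is attained at the adjoints of the unitary factors of
the singular value decomposition. -/
theorem exists_unitary_schattenNorm_eq {d : ℕ} (hp' : p ≠ ∞) (A : Matrix (Fin d) (Fin d) ℂ) :
    ∃ X Y : Matrix (Fin d) (Fin d) ℂ, ‖X‖ ≤ 1 ∧ ‖Y‖ ≤ 1 ∧
      schattenNorm p A = (∑ i, ‖(X * A * Y) i i‖ ^ p.toReal) ^ (1 / p.toReal) := by
  obtain ⟨U, V, s, hs, hA, h⟩ := exists_singularValues A
  refine ⟨(star U : Matrix.unitaryGroup (Fin d) ℂ), (star V : Matrix.unitaryGroup (Fin d) ℂ),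
    Matrix.unitaryGroup.l2_opNorm_le_one _, Matrix.unitaryGroup.l2_opNorm_le_one _, ?_⟩
  have hD : ((star U : Matrix.unitaryGroup (Fin d) ℂ) : Matrix (Fin d) (Fin d) ℂ) * A *
      ((star V : Matrix.unitaryGroup (Fin d) ℂ) : Matrix (Fin d) (Fin d) ℂ) =
      Matrix.diagonal fun i => (s i : ℂ) := by
    have hU : star (U : Matrix (Fin d) (Fin d) ℂ) * U = 1 := by simp
    have hV : (V : Matrix (Fin d) (Fin d) ℂ) * star (V : Matrix (Fin d) (Fin d) ℂ) = 1 := by simp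
    rw [hA, Unitary.coe_star, Unitary.coe_star, Matrix.mul_assoc, Matrix.mul_assoc, hV,
      Matrix.mul_one, ← Matrix.mul_assoc, hU, Matrix.one_mul]
  rw [h p hp', hD]
  simp [abs_of_nonneg, hs]

/-- `X` and `Y` are absorbed into the contractions of the variational formula. Rectangular factors
are allowed in order to cover inclusions of and compressions to direct summands. -/
theorem schattenNorm_mul_mul_le {m n : ℕ} (hp : 1 ≤ p) {X : Matrix (Fin m) (Fin n) ℂ}
    {Y : Matrix (Fin n) (Fin m) ℂ} (hX : ‖X‖ ≤ 1) (hY : ‖Y‖ ≤ 1)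
    (A : Matrix (Fin n) (Fin n) ℂ) : schattenNorm p (X * A * Y) ≤ schattenNorm p A := by
  by_cases hp' : p = ∞
  · subst hp'
    rw [schattenNorm_top, schattenNorm_top]
    calc ‖X * A * Y‖ ≤ ‖X‖ * ‖A‖ * ‖Y‖ := (Matrix.l2_opNorm_mul _ _).trans
          (mul_le_mul_of_nonneg_right (Matrix.l2_opNorm_mul _ _) (norm_nonneg _))
      _ ≤ 1 * ‖A‖ * 1 := by gcongr
      _ = ‖A‖ := by ring
  · obtain ⟨X', Y', hX', hY', h⟩ := exists_unitary_schattenNorm_eq hp' (X * A * Y)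
    rw [h]
    have key := lpNorm_diag_le_schattenNorm hp hp' (X := X' * X) (Y := Y * Y')
      ((Matrix.l2_opNorm_mul _ _).trans (mul_le_one₀ hX' (norm_nonneg _) hX))
      ((Matrix.l2_opNorm_mul _ _).trans (mul_le_one₀ hY (norm_nonneg _) hY')) A
    simpa only [Matrix.mul_assoc] using key

/-- Minkowski's inequality for the diagonal of `X * (A + B) * Y`, with `X`, `Y` optimal for `A + B`.
-/
theorem schattenNorm_add_le {d : ℕ} (hp : 1 ≤ p) (A B : Matrix (Fin d) (Fin d) ℂ) :
    schattenNorm p (A + B) ≤ schattenNorm p A + schattenNorm p B := by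
  by_cases hp' : p = ∞
  · subst hp'
    simpa only [schattenNorm_top] using norm_add_le A B
  · have hr := one_le_toReal_of_one_le hp hp'
    obtain ⟨X, Y, hX, hY, h⟩ := exists_unitary_schattenNorm_eq hp' (A + B)
    rw [h]
    refine le_trans ?_ (add_le_add (lpNorm_diag_le_schattenNorm hp hp' hX hY A)
      (lpNorm_diag_le_schattenNorm hp hp' hX hY B))
    refine le_trans ?_ (Real.Lp_add_le_of_nonneg Finset.univ hr (fun _ _ => norm_nonneg _)
      (fun _ _ => norm_nonneg _))
    gcongr with i
    rw [Matrix.mul_add, Matrix.add_mul, Matrix.add_apply]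
    exact norm_add_le _ _

theorem schattenNorm_smul_le {d : ℕ} (hp : 1 ≤ p) (c : ℂ) (A : Matrix (Fin d) (Fin d) ℂ) :
    schattenNorm p (c • A) ≤ ‖c‖ * schattenNorm p A := by
  by_cases hp' : p = ∞
  · subst hp'
    simpa only [schattenNorm_top] using norm_smul_le c A
  · have hr := one_le_toReal_of_one_le hp hp'
    obtain ⟨X, Y, hX, hY, h⟩ := exists_unitary_schattenNorm_eq hp' (c • A)
    rw [h]
    refine le_trans (le_of_eq ?_) (mul_le_mul_of_nonneg_left
      (lpNorm_diag_le_schattenNorm hp hp' hX hY A) (norm_nonneg c))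
    simp only [Matrix.mul_smul, Matrix.smul_mul, Matrix.smul_apply, norm_smul,
      Real.mul_rpow (norm_nonneg c) (norm_nonneg _), ← Finset.mul_sum]
    rw [Real.mul_rpow (by positivity) (by positivity), ← Real.rpow_mul (norm_nonneg c),
      mul_one_div_cancel (by linarith), Real.rpow_one]

theorem schattenNorm_zero {d : ℕ} (hp : 1 ≤ p) :
    schattenNorm p (0 : Matrix (Fin d) (Fin d) ℂ) = 0 :=
  le_antisymm (by simpa using schattenNorm_smul_le hp 0 (0 : Matrix (Fin d) (Fin d) ℂ))
    (schattenNorm_nonneg _)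

theorem schattenNorm_smul {d : ℕ} (hp : 1 ≤ p) (c : ℂ) (A : Matrix (Fin d) (Fin d) ℂ) :
    schattenNorm p (c • A) = ‖c‖ * schattenNorm p A := by
  rcases eq_or_ne c 0 with rfl | hc
  · simp [schattenNorm_zero hp]
  · refine le_antisymm (schattenNorm_smul_le hp c A) ?_
    have h := schattenNorm_smul_le hp c⁻¹ (c • A)
    rw [inv_smul_smul₀ hc, norm_inv] at h
    calc ‖c‖ * schattenNorm p A ≤ ‖c‖ * (‖c‖⁻¹ * schattenNorm p (c • A)) := by gcongr
      _ = schattenNorm p (c • A) := mul_inv_cancel_left₀ (norm_ne_zero_iff.2 hc) _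

theorem schattenNorm_neg {d : ℕ} (hp : 1 ≤ p) (A : Matrix (Fin d) (Fin d) ℂ) :
    schattenNorm p (-A) = schattenNorm p A := by
  simpa using schattenNorm_smul hp (-1) A

theorem schattenNorm_sub_le {d : ℕ} (hp : 1 ≤ p) (A B : Matrix (Fin d) (Fin d) ℂ) :
    schattenNorm p (A - B) ≤ schattenNorm p A + schattenNorm p B := by
  rw [sub_eq_add_neg, ← schattenNorm_neg hp B]
  exact schattenNorm_add_le hp A (-B)

theorem schattenNorm_mul_le {d : ℕ} (hp : 1 ≤ p) (A B : Matrix (Fin d) (Fin d) ℂ) :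
    schattenNorm p (A * B) ≤ schattenNorm p A * ‖B‖ := by
  rcases eq_or_ne B 0 with rfl | hB
  · simp [schattenNorm_zero hp]
  have hB' : (‖B‖ : ℂ) ≠ 0 := by exact_mod_cast norm_ne_zero_iff.2 hB
  have h1 : ‖(‖B‖ : ℂ)⁻¹ • B‖ ≤ 1 := by
    rw [norm_smul, norm_inv, Complex.norm_real, norm_norm, inv_mul_cancel₀ (norm_ne_zero_iff.2 hB)]
  have hone : ‖(1 : Matrix (Fin d) (Fin d) ℂ)‖ ≤ 1 := Matrix.unitaryGroup.l2_opNorm_le_one 1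
  have h := schattenNorm_mul_mul_le hp hone h1 A
  have h2 : A * B = (‖B‖ : ℂ) • (1 * A * ((‖B‖ : ℂ)⁻¹ • B)) := by
    rw [Matrix.mul_smul, smul_inv_smul₀ hB', Matrix.one_mul]
  rw [h2, schattenNorm_smul hp, Complex.norm_real, norm_norm, mul_comm]
  gcongr

theorem schattenNorm_unitary_mul_le {d : ℕ} (hp : 1 ≤ p) (U : Matrix.unitaryGroup (Fin d) ℂ)
    (A : Matrix (Fin d) (Fin d) ℂ) :
    schattenNorm p ((U : Matrix (Fin d) (Fin d) ℂ) * A) ≤ schattenNorm p A := by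
  simpa using schattenNorm_mul_mul_le hp (Matrix.unitaryGroup.l2_opNorm_le_one U)
    (Matrix.unitaryGroup.l2_opNorm_le_one 1) A

theorem schattenNorm_mul_unitary_le {d : ℕ} (hp : 1 ≤ p) (A : Matrix (Fin d) (Fin d) ℂ)
    (U : Matrix.unitaryGroup (Fin d) ℂ) :
    schattenNorm p (A * (U : Matrix (Fin d) (Fin d) ℂ)) ≤ schattenNorm p A := by
  simpa using schattenNorm_mul_mul_le hp (Matrix.unitaryGroup.l2_opNorm_le_one 1)
    (Matrix.unitaryGroup.l2_opNorm_le_one U) A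

/-- Each singular value is at most `T = ‖A‖_p`, so `s i ^ q ≤ s i ^ p * T ^ (q - p)`; summing gives
`T ^ q`. -/
theorem schattenNorm_antitone {d : ℕ} {q : ℝ≥0∞} (hp : 1 ≤ p) (hpq : p ≤ q)
    (A : Matrix (Fin d) (Fin d) ℂ) : schattenNorm q A ≤ schattenNorm p A := by
  by_cases hp' : p = ∞
  · rw [hp', top_le_iff] at hpq
    rw [hp', hpq]
  have hr := one_le_toReal_of_one_le hp hp'
  obtain ⟨U, V, s, hs, hA, h⟩ := exists_singularValues A
  have hsum : 0 ≤ ∑ i, s i ^ p.toReal := Finset.sum_nonneg fun i _ => Real.rpow_nonneg (hs i) _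
  set T := schattenNorm p A with hT
  have hT0 : 0 ≤ T := schattenNorm_nonneg A
  have hTp : T ^ p.toReal = ∑ i, s i ^ p.toReal := by
    rw [hT, h p hp', ← Real.rpow_mul hsum, one_div_mul_cancel (by linarith), Real.rpow_one]
  have hsT : ∀ i, s i ≤ T := fun i => by
    rw [← Real.rpow_le_rpow_iff (hs i) hT0 (by linarith : 0 < p.toReal), hTp]
    exact Finset.single_le_sum (f := fun i => s i ^ p.toReal)
      (fun i _ => Real.rpow_nonneg (hs i) _) (Finset.mem_univ i)
  by_cases hq' : q = ∞
  · subst hq'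
    rw [schattenNorm_top, hA]
    have hD : ‖(Matrix.diagonal fun i => (s i : ℂ) : Matrix (Fin d) (Fin d) ℂ)‖ ≤ T := by
      rw [Matrix.l2_opNorm_diagonal]
      exact (pi_norm_le_iff_of_nonneg hT0).2 fun i => by simpa [abs_of_nonneg (hs i)] using hsT i
    calc _ ≤ ‖(U : Matrix (Fin d) (Fin d) ℂ)‖ *
          ‖(Matrix.diagonal fun i => (s i : ℂ) : Matrix (Fin d) (Fin d) ℂ)‖ *
          ‖(V : Matrix (Fin d) (Fin d) ℂ)‖ := (Matrix.l2_opNorm_mul _ _).trans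
          (mul_le_mul_of_nonneg_right (Matrix.l2_opNorm_mul _ _) (norm_nonneg _))
      _ ≤ 1 * T * 1 := by
          gcongr
          · exact Matrix.unitaryGroup.l2_opNorm_le_one U
          · exact Matrix.unitaryGroup.l2_opNorm_le_one V
      _ = T := by ring
  · have hpq' : p.toReal ≤ q.toReal := ENNReal.toReal_mono hq' hpq
    have hq0 : 0 < q.toReal := by linarith
    have hle : ∑ i, s i ^ q.toReal ≤ T ^ q.toReal := by
      calc ∑ i, s i ^ q.toReal ≤ ∑ i, s i ^ p.toReal * T ^ (q.toReal - p.toReal) := by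
            refine Finset.sum_le_sum fun i _ => ?_
            rcases (hs i).eq_or_lt with h0 | h0
            · rw [← h0, Real.zero_rpow (by linarith), Real.zero_rpow (by linarith), zero_mul]
            · calc s i ^ q.toReal = s i ^ p.toReal * s i ^ (q.toReal - p.toReal) := by
                    rw [← Real.rpow_add h0]
                    ring_nf
                _ ≤ _ := mul_le_mul_of_nonneg_left
                    (Real.rpow_le_rpow (hs i) (hsT i) (by linarith)) (Real.rpow_nonneg (hs i) _)
        _ = T ^ p.toReal * T ^ (q.toReal - p.toReal) := by rw [← Finset.sum_mul, hTp]
        _ = T ^ q.toReal := by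
            rw [← Real.rpow_add' hT0 (by linarith)]
            ring_nf
    rw [h q hq']
    calc _ ≤ (T ^ q.toReal) ^ (1 / q.toReal) := Real.rpow_le_rpow
          (Finset.sum_nonneg fun i _ => Real.rpow_nonneg (hs i) _) hle (by positivity)
      _ = T := by rw [← Real.rpow_mul hT0, mul_one_div_cancel hq0.ne', Real.rpow_one]

end SchattenNorm

/-! ### Direct sums of matrices and of unitaries. -/

section DirectSum

open scoped Matrix.Norms.L2Operator

/-- The inclusion of the first summand in `ℂ ^ (m + n)`. -/
def leftIncl (m n : ℕ) : Matrix (Fin (m + n)) (Fin m) ℂ :=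
  (1 : Matrix (Fin (m + n)) (Fin (m + n)) ℂ).submatrix id (Fin.castAdd n)

/-- The inclusion of the second summand in `ℂ ^ (m + n)`. -/
def rightIncl (m n : ℕ) : Matrix (Fin (m + n)) (Fin n) ℂ :=
  (1 : Matrix (Fin (m + n)) (Fin (m + n)) ℂ).submatrix id (Fin.natAdd m)

theorem conjTranspose_leftIncl_mul_leftIncl (m n : ℕ) : (leftIncl m n)ᴴ * leftIncl m n = 1 := by
  ext i j
  simp [leftIncl, Matrix.mul_apply, Matrix.one_apply]

theorem conjTranspose_rightIncl_mul_rightIncl (m n : ℕ) :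
    (rightIncl m n)ᴴ * rightIncl m n = 1 := by
  ext i j
  simp [rightIncl, Matrix.mul_apply, Matrix.one_apply]

theorem conjTranspose_leftIncl_mul_rightIncl (m n : ℕ) :
    (leftIncl m n)ᴴ * rightIncl m n = 0 := by
  ext i j
  have h : Fin.natAdd m j ≠ Fin.castAdd n i := fun h => by
    have := congrArg Fin.val h
    simp only [Fin.val_natAdd, Fin.val_castAdd] at this
    omega
  simp [leftIncl, rightIncl, Matrix.mul_apply, Matrix.one_apply, h.symm]

theorem conjTranspose_rightIncl_mul_leftIncl (m n : ℕ) :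
    (rightIncl m n)ᴴ * leftIncl m n = 0 := by
  simpa using congrArg Matrix.conjTranspose (conjTranspose_leftIncl_mul_rightIncl m n)

theorem leftIncl_mul_add_rightIncl_mul (m n : ℕ) :
    leftIncl m n * (leftIncl m n)ᴴ + rightIncl m n * (rightIncl m n)ᴴ = 1 := by
  -- Splitting the summation index of `1 * 1ᴴ` at `m` yields the two terms on the left.
  have h : (1 : Matrix (Fin (m + n)) (Fin (m + n)) ℂ) * 1ᴴ = 1 := by simp
  conv_rhs => rw [← h]
  ext i j
  rw [Matrix.add_apply, Matrix.mul_apply, Matrix.mul_apply, Matrix.mul_apply, Fin.sum_univ_add]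
  rfl

/-- The direct sum of two square matrices. -/
def matrixDirectSum {m n : ℕ} (A : Matrix (Fin m) (Fin m) ℂ) (B : Matrix (Fin n) (Fin n) ℂ) :
    Matrix (Fin (m + n)) (Fin (m + n)) ℂ :=
  leftIncl m n * A * (leftIncl m n)ᴴ + rightIncl m n * B * (rightIncl m n)ᴴ

theorem matrixDirectSum_mul {m n : ℕ} (A A' : Matrix (Fin m) (Fin m) ℂ)
    (B B' : Matrix (Fin n) (Fin n) ℂ) :
    matrixDirectSum A B * matrixDirectSum A' B' = matrixDirectSum (A * A') (B * B') := by
  have h : ∀ {k l a b : ℕ} (X : Matrix (Fin k) (Fin a) ℂ) (A : Matrix (Fin a) (Fin a) ℂ)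
      (Y : Matrix (Fin a) (Fin k) ℂ) (Z : Matrix (Fin k) (Fin b) ℂ)
      (B : Matrix (Fin b) (Fin b) ℂ) (W : Matrix (Fin b) (Fin l) ℂ),
      X * A * Y * (Z * B * W) = X * A * (Y * Z) * B * W := by
    intros
    simp only [Matrix.mul_assoc]
  simp only [matrixDirectSum, Matrix.add_mul, Matrix.mul_add, h,
    conjTranspose_leftIncl_mul_leftIncl, conjTranspose_rightIncl_mul_rightIncl,
    conjTranspose_leftIncl_mul_rightIncl, conjTranspose_rightIncl_mul_leftIncl, Matrix.mul_zero,
    Matrix.zero_mul, Matrix.mul_one, add_zero, zero_add]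
  simp only [Matrix.mul_assoc]

theorem matrixDirectSum_one (m n : ℕ) :
    matrixDirectSum (1 : Matrix (Fin m) (Fin m) ℂ) (1 : Matrix (Fin n) (Fin n) ℂ) = 1 := by
  simp [matrixDirectSum, leftIncl_mul_add_rightIncl_mul]

theorem star_matrixDirectSum {m n : ℕ} (A : Matrix (Fin m) (Fin m) ℂ)
    (B : Matrix (Fin n) (Fin n) ℂ) :
    star (matrixDirectSum A B) = matrixDirectSum (star A) (star B) := by
  simp [matrixDirectSum, Matrix.star_eq_conjTranspose, Matrix.mul_assoc]

theorem matrixDirectSum_sub {m n : ℕ} (A A' : Matrix (Fin m) (Fin m) ℂ)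
    (B B' : Matrix (Fin n) (Fin n) ℂ) :
    matrixDirectSum A B - matrixDirectSum A' B' = matrixDirectSum (A - A') (B - B') := by
  simp only [matrixDirectSum, Matrix.mul_sub, Matrix.sub_mul]
  abel

variable {p : ℝ≥0∞} {m n : ℕ}

theorem l2_opNorm_leftIncl_le (m n : ℕ) : ‖leftIncl m n‖ ≤ 1 :=
  Matrix.l2_opNorm_le_one_of_conjTranspose_mul_self (conjTranspose_leftIncl_mul_leftIncl m n)

theorem l2_opNorm_rightIncl_le (m n : ℕ) : ‖rightIncl m n‖ ≤ 1 :=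
  Matrix.l2_opNorm_le_one_of_conjTranspose_mul_self (conjTranspose_rightIncl_mul_rightIncl m n)

theorem schattenNorm_matrixDirectSum_le (hp : 1 ≤ p) (A : Matrix (Fin m) (Fin m) ℂ)
    (B : Matrix (Fin n) (Fin n) ℂ) :
    schattenNorm p (matrixDirectSum A B) ≤ schattenNorm p A + schattenNorm p B :=
  (schattenNorm_add_le hp _ _).trans (add_le_add
    (schattenNorm_mul_mul_le hp (l2_opNorm_leftIncl_le m n)
      (by rw [Matrix.l2_opNorm_conjTranspose]; exact l2_opNorm_leftIncl_le m n) A)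
    (schattenNorm_mul_mul_le hp (l2_opNorm_rightIncl_le m n)
      (by rw [Matrix.l2_opNorm_conjTranspose]; exact l2_opNorm_rightIncl_le m n) B))

theorem schattenNorm_left_le_matrixDirectSum (hp : 1 ≤ p) (A : Matrix (Fin m) (Fin m) ℂ)
    (B : Matrix (Fin n) (Fin n) ℂ) :
    schattenNorm p A ≤ schattenNorm p (matrixDirectSum A B) := by
  have h := schattenNorm_mul_mul_le hp
    (by rw [Matrix.l2_opNorm_conjTranspose]; exact l2_opNorm_leftIncl_le m n :
      ‖(leftIncl m n)ᴴ‖ ≤ 1) (l2_opNorm_leftIncl_le m n) (matrixDirectSum A B)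
  have hA : (leftIncl m n)ᴴ * matrixDirectSum A B * leftIncl m n = A := by
    have e : ∀ {a : ℕ} (X : Matrix (Fin (m + n)) (Fin a) ℂ) (C : Matrix (Fin a) (Fin a) ℂ),
        (leftIncl m n)ᴴ * (X * C * Xᴴ) * leftIncl m n =
          ((leftIncl m n)ᴴ * X) * C * (Xᴴ * leftIncl m n) := by
      intros
      simp only [Matrix.mul_assoc]
    rw [matrixDirectSum, Matrix.mul_add, Matrix.add_mul, e, e,
      conjTranspose_leftIncl_mul_leftIncl, conjTranspose_rightIncl_mul_leftIncl]
    simp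
  rwa [hA] at h

theorem schattenNorm_right_le_matrixDirectSum (hp : 1 ≤ p) (A : Matrix (Fin m) (Fin m) ℂ)
    (B : Matrix (Fin n) (Fin n) ℂ) :
    schattenNorm p B ≤ schattenNorm p (matrixDirectSum A B) := by
  have h := schattenNorm_mul_mul_le hp
    (by rw [Matrix.l2_opNorm_conjTranspose]; exact l2_opNorm_rightIncl_le m n :
      ‖(rightIncl m n)ᴴ‖ ≤ 1) (l2_opNorm_rightIncl_le m n) (matrixDirectSum A B)
  have hB : (rightIncl m n)ᴴ * matrixDirectSum A B * rightIncl m n = B := by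
    have e : ∀ {a : ℕ} (X : Matrix (Fin (m + n)) (Fin a) ℂ) (C : Matrix (Fin a) (Fin a) ℂ),
        (rightIncl m n)ᴴ * (X * C * Xᴴ) * rightIncl m n =
          ((rightIncl m n)ᴴ * X) * C * (Xᴴ * rightIncl m n) := by
      intros
      simp only [Matrix.mul_assoc]
    rw [matrixDirectSum, Matrix.mul_add, Matrix.add_mul, e, e,
      conjTranspose_rightIncl_mul_rightIncl, conjTranspose_leftIncl_mul_rightIncl]
    simp
  rwa [hB] at h

/-- The direct sum of two unitary matrices. -/
def unitaryDirectSum (u : Matrix.unitaryGroup (Fin m) ℂ) (v : Matrix.unitaryGroup (Fin n) ℂ) :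
    Matrix.unitaryGroup (Fin (m + n)) ℂ :=
  ⟨matrixDirectSum u v, Matrix.mem_unitaryGroup_iff.2 (by
    rw [star_matrixDirectSum, matrixDirectSum_mul]
    simp [matrixDirectSum_one])⟩

theorem unitaryDirectSum_mul (u u' : Matrix.unitaryGroup (Fin m) ℂ)
    (v v' : Matrix.unitaryGroup (Fin n) ℂ) :
    unitaryDirectSum u v * unitaryDirectSum u' v' = unitaryDirectSum (u * u') (v * v') :=
  Subtype.ext (matrixDirectSum_mul _ _ _ _)

theorem unitaryDirectSum_one :
    unitaryDirectSum (1 : Matrix.unitaryGroup (Fin m) ℂ) (1 : Matrix.unitaryGroup (Fin n) ℂ) = 1 :=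
  Subtype.ext (matrixDirectSum_one m n)

variable (u u' : Matrix.unitaryGroup (Fin m) ℂ) (v v' : Matrix.unitaryGroup (Fin n) ℂ)

theorem schattenDist_unitaryDirectSum_le (hp : 1 ≤ p) :
    schattenDist p (unitaryDirectSum u v) (unitaryDirectSum u' v') ≤
      schattenDist p u u' + schattenDist p v v' := by
  have h := schattenNorm_matrixDirectSum_le hp
    ((u : Matrix (Fin m) (Fin m) ℂ) - (u' : Matrix (Fin m) (Fin m) ℂ))
    ((v : Matrix (Fin n) (Fin n) ℂ) - (v' : Matrix (Fin n) (Fin n) ℂ))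
  rwa [← matrixDirectSum_sub] at h

theorem schattenDist_left_le_unitaryDirectSum (hp : 1 ≤ p) :
    schattenDist p u u' ≤ schattenDist p (unitaryDirectSum u v) (unitaryDirectSum u' v') := by
  have h := schattenNorm_left_le_matrixDirectSum hp
    ((u : Matrix (Fin m) (Fin m) ℂ) - (u' : Matrix (Fin m) (Fin m) ℂ))
    ((v : Matrix (Fin n) (Fin n) ℂ) - (v' : Matrix (Fin n) (Fin n) ℂ))
  rwa [← matrixDirectSum_sub] at h

theorem schattenDist_right_le_unitaryDirectSum (hp : 1 ≤ p) :
    schattenDist p v v' ≤ schattenDist p (unitaryDirectSum u v) (unitaryDirectSum u' v') := by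
  have h := schattenNorm_right_le_matrixDirectSum hp
    ((u : Matrix (Fin m) (Fin m) ℂ) - (u' : Matrix (Fin m) (Fin m) ℂ))
    ((v : Matrix (Fin n) (Fin n) ℂ) - (v' : Matrix (Fin n) (Fin n) ℂ))
  rwa [← matrixDirectSum_sub] at h

end DirectSum

/-! ### The bi-invariant distance on the unitary group, and unitaries near `1`. -/

section Distance

open scoped Matrix.Norms.L2Operator

variable {p : ℝ≥0∞} {d : ℕ}

theorem schattenDist_nonneg (u v : Matrix.unitaryGroup (Fin d) ℂ) : 0 ≤ schattenDist p u v :=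
  schattenNorm_nonneg _

theorem schattenDist_self (hp : 1 ≤ p) (u : Matrix.unitaryGroup (Fin d) ℂ) :
    schattenDist p u u = 0 := by
  rw [schattenDist, sub_self, schattenNorm_zero hp]

theorem schattenDist_comm (hp : 1 ≤ p) (u v : Matrix.unitaryGroup (Fin d) ℂ) :
    schattenDist p u v = schattenDist p v u := by
  rw [schattenDist, ← schattenNorm_neg hp, neg_sub, schattenDist]

theorem schattenDist_triangle (hp : 1 ≤ p) (u v w : Matrix.unitaryGroup (Fin d) ℂ) :
    schattenDist p u w ≤ schattenDist p u v + schattenDist p v w := by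
  simpa [schattenDist] using schattenNorm_add_le hp
    ((u : Matrix (Fin d) (Fin d) ℂ) - (v : Matrix (Fin d) (Fin d) ℂ))
    ((v : Matrix (Fin d) (Fin d) ℂ) - (w : Matrix (Fin d) (Fin d) ℂ))

theorem schattenDist_mul_left_le (hp : 1 ≤ p) (w u v : Matrix.unitaryGroup (Fin d) ℂ) :
    schattenDist p (w * u) (w * v) ≤ schattenDist p u v := by
  have h := schattenNorm_unitary_mul_le hp w
    ((u : Matrix (Fin d) (Fin d) ℂ) - (v : Matrix (Fin d) (Fin d) ℂ))
  rwa [Matrix.mul_sub] at h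

theorem schattenDist_mul_right_le (hp : 1 ≤ p) (u v w : Matrix.unitaryGroup (Fin d) ℂ) :
    schattenDist p (u * w) (v * w) ≤ schattenDist p u v := by
  have h := schattenNorm_mul_unitary_le hp
    ((u : Matrix (Fin d) (Fin d) ℂ) - (v : Matrix (Fin d) (Fin d) ℂ)) w
  rwa [Matrix.sub_mul] at h

theorem schattenDist_pow_one_le (hp : 1 ≤ p) (u : Matrix.unitaryGroup (Fin d) ℂ) (k : ℕ) :
    schattenDist p (u ^ k) 1 ≤ k * schattenDist p u 1 := by
  induction k with
  | zero => simp [schattenDist_self hp]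
  | succ k ih =>
    have h1 := schattenDist_triangle hp (u ^ (k + 1)) u 1
    have h2 := schattenDist_mul_right_le hp (u ^ k) 1 u
    rw [one_mul, ← pow_succ] at h2
    push_cast
    linarith

/-- A unitary close to `1` in operator norm is controlled in Schatten norm by its powers. -/
theorem schattenDist_one_le_of_norm_le (hp : 1 ≤ p) {k : ℕ} (hk : 0 < k)
    (u : Matrix.unitaryGroup (Fin d) ℂ) (hu : schattenDist ∞ u 1 ≤ 1 / (2 * k)) :
    schattenDist p u 1 ≤ 2 / k * schattenDist p (u ^ k) 1 := by
  have hk' : (0 : ℝ) < k := by exact_mod_cast hk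
  set M : Matrix (Fin d) (Fin d) ℂ := (u : Matrix (Fin d) (Fin d) ℂ) with hM
  have hR : ‖∑ i ∈ Finset.range k, (M ^ i - 1)‖ ≤ k / 2 := by
    calc ‖∑ i ∈ Finset.range k, (M ^ i - 1)‖ ≤ ∑ i ∈ Finset.range k, ‖M ^ i - 1‖ := norm_sum_le _ _
      _ ≤ ∑ i ∈ Finset.range k, (1 / 2 : ℝ) := by
          refine Finset.sum_le_sum fun i hi => ?_
          have h := schattenDist_pow_one_le le_top u i
          have h' : schattenDist ∞ (u ^ i) 1 = ‖M ^ i - 1‖ := by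
            simp [schattenDist, schattenNorm_top, hM]
          have hik : (i : ℝ) ≤ k := by exact_mod_cast (Finset.mem_range.1 hi).le
          rw [h'] at h
          calc ‖M ^ i - 1‖ ≤ i * schattenDist ∞ u 1 := h
            _ ≤ k * (1 / (2 * k)) := mul_le_mul hik hu (schattenDist_nonneg _ _) hk'.le
            _ = 1 / 2 := by field_simp
      _ = k / 2 := by simp [div_eq_mul_inv]
  -- The geometric sum `(M - 1) * ∑ M ^ i = M ^ k - 1`, with `k` copies of `M - 1` split off. By
  -- `hR` the last product has `p`-norm at most half that of the left side, so it can be absorbed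
  -- there.
  have hid : (k : ℂ) • (M - 1) = (M ^ k - 1) - (M - 1) * ∑ i ∈ Finset.range k, (M ^ i - 1) := by
    rw [Finset.sum_sub_distrib, mul_sub, mul_geom_sum, Finset.sum_const, Finset.card_range,
      sub_sub_cancel, mul_smul_comm, mul_one, Nat.cast_smul_eq_nsmul]
  have h1 : (k : ℝ) * schattenNorm p (M - 1) = schattenNorm p ((k : ℂ) • (M - 1)) := by
    rw [schattenNorm_smul hp]
    simp
  have h2 : schattenDist p (u ^ k) 1 = schattenNorm p (M ^ k - 1) := by simp [schattenDist, hM]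
  have h3 : schattenDist p u 1 = schattenNorm p (M - 1) := by simp [schattenDist, hM]
  have h4 := schattenNorm_sub_le hp (M ^ k - 1) ((M - 1) * ∑ i ∈ Finset.range k, (M ^ i - 1))
  have h5 := schattenNorm_mul_le hp (M - 1) (∑ i ∈ Finset.range k, (M ^ i - 1))
  have h6 := mul_le_mul_of_nonneg_left hR (schattenNorm_nonneg (p := p) (M - 1))
  rw [← hid, ← h1] at h4
  rw [h2, h3, div_mul_eq_mul_div, le_div_iff₀ hk']
  linarith

end Distance

/-! ### Asymptotic homomorphisms and the first part of the theorem. -/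

section Approximation

variable {p q : ℝ≥0∞} {Γ : Type*} [Group Γ] {d : ℕ → ℕ}
  {φ : ∀ n, Γ → Matrix.unitaryGroup (Fin (d n)) ℂ}

theorem zero_lt_liminf_ofReal_iff {f : ℕ → ℝ} :
    0 < liminf (fun n => ENNReal.ofReal (f n)) atTop ↔ ∃ c > 0, ∀ᶠ n in atTop, c ≤ f n := by
  constructor
  · intro h
    obtain ⟨c, hc0, hc⟩ := exists_between h
    have hct : c ≠ ∞ := hc.ne_top
    refine ⟨c.toReal, ENNReal.toReal_pos hc0.ne' hct, ?_⟩
    filter_upwards [eventually_lt_of_lt_liminf hc] with n hn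
    by_contra! hlt
    exact absurd (ENNReal.ofReal_le_of_le_toReal hlt.le) (not_le.2 hn)
  · rintro ⟨c, hc, h⟩
    refine (ENNReal.ofReal_pos.2 hc).trans_le (le_liminf_of_le (h := ?_))
    filter_upwards [h] with n hn using ENNReal.ofReal_le_ofReal hn

theorem IsAsymptoticHom.mono (hp : 1 ≤ p) (hpq : p ≤ q) (hφ : IsAsymptoticHom p φ) :
    IsAsymptoticHom q φ := fun g h =>
  squeeze_zero (fun _ => schattenDist_nonneg _ _) (fun _ => schattenNorm_antitone hp hpq _)
    (hφ g h)

theorem IsAsymptoticHom.tendsto_one (hp : 1 ≤ p) (hφ : IsAsymptoticHom p φ) :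
    Tendsto (fun n => schattenDist p (φ n 1) 1) atTop (𝓝 0) := by
  refine squeeze_zero (fun _ => schattenDist_nonneg _ _) (fun n => ?_) (hφ 1 1)
  -- Cancelling `φ n 1` turns the multiplicativity defect at `(1, 1)` into the distance from `φ n 1`
  -- to `1`.
  have h := schattenDist_mul_left_le hp (φ n 1)⁻¹ (φ n (1 * 1)) (φ n 1 * φ n 1)
  rw [mul_one, inv_mul_cancel, inv_mul_cancel_left, schattenDist_comm hp] at h
  simpa using h

theorem IsAsymptoticHom.tendsto_pow (hp : 1 ≤ p) (hφ : IsAsymptoticHom p φ) (g : Γ) (k : ℕ) :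
    Tendsto (fun n => schattenDist p (φ n g ^ k) (φ n (g ^ k))) atTop (𝓝 0) := by
  induction k with
  | zero =>
    refine (hφ.tendsto_one hp).congr fun n => ?_
    rw [pow_zero, pow_zero, schattenDist_comm hp]
  | succ k ih =>
    refine squeeze_zero (fun _ => schattenDist_nonneg _ _) (fun n => ?_)
      (by simpa using ih.add (hφ (g ^ k) g))
    have h1 := schattenDist_triangle hp (φ n g ^ (k + 1)) (φ n (g ^ k) * φ n g) (φ n (g ^ (k + 1)))
    have h2 := schattenDist_mul_right_le hp (φ n g ^ k) (φ n (g ^ k)) (φ n g)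
    rw [schattenDist_comm hp (φ n (g ^ k) * φ n g)] at h1
    simp only [pow_succ] at h1 ⊢
    linarith

/-- For an asymptotic homomorphism, an element of finite order that stays away from `1` in a
Schatten norm stays away from `1` in operator norm. -/
theorem IsAsymptoticHom.exists_le_schattenDist_top (hp : 1 ≤ p) (hφ : IsAsymptoticHom p φ)
    {g : Γ} (hg : IsOfFinOrder g) {c : ℝ} (hc : 0 < c)
    (hsep : ∀ᶠ n in atTop, c ≤ schattenDist p (φ n g) 1) :
    ∃ c' > 0, ∀ᶠ n in atTop, c' ≤ schattenDist ∞ (φ n g) 1 := by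
  have hk := hg.orderOf_pos
  have hk' : (0 : ℝ) < orderOf g := by exact_mod_cast hk
  have hlim : Tendsto (fun n => schattenDist p (φ n g ^ orderOf g) 1) atTop (𝓝 0) := by
    refine squeeze_zero (fun _ => schattenDist_nonneg _ _)
      (fun n => schattenDist_triangle hp _ (φ n (g ^ orderOf g)) 1) ?_
    rw [pow_orderOf_eq_one]
    have h := (hφ.tendsto_pow hp g (orderOf g)).add (hφ.tendsto_one hp)
    rw [pow_orderOf_eq_one] at h
    simpa using h
  have hlim' := hlim.const_mul (2 / (orderOf g : ℝ))
  rw [mul_zero] at hlim'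
  refine ⟨1 / (2 * orderOf g), by positivity, ?_⟩
  filter_upwards [hsep, hlim'.eventually_lt_const hc] with n hn hn'
  by_contra! hlt
  have := schattenDist_one_le_of_norm_le hp hk (φ n g) hlt.le
  linarith

theorem IsSchattenApproximated.of_quotient_finite (N : Subgroup Γ) [N.Normal] [Finite N]
    (hp : 1 ≤ p) (hpq : p ≤ q) (hN : IsSchattenApproximated q (Γ ⧸ N))
    (hΓ : IsSchattenApproximated p Γ) : IsSchattenApproximated q Γ := by
  obtain ⟨d, φ, hφ, hφs⟩ := hΓ
  obtain ⟨e, ψ, hψ, hψs⟩ := hN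
  have hq := hp.trans hpq
  refine ⟨fun n => d n + e n, fun n g => unitaryDirectSum (φ n g) (ψ n g), fun g h => ?_,
    fun g hg => ?_⟩
  · refine squeeze_zero (fun _ => schattenDist_nonneg _ _) (fun n => ?_)
      (by simpa using (hφ.mono hp hpq g h).add (hψ (g : Γ ⧸ N) (h : Γ ⧸ N)))
    rw [unitaryDirectSum_mul]
    exact schattenDist_unitaryDirectSum_le _ _ _ _ hq
  · rw [zero_lt_liminf_ofReal_iff]
    by_cases hgN : g ∈ N
    · obtain ⟨c, hc, hsep⟩ := zero_lt_liminf_ofReal_iff.1 (hφs g hg)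
      have hfin : IsOfFinOrder g :=
        MonoidHom.isOfFinOrder N.subtype (isOfFinOrder_of_finite (⟨g, hgN⟩ : N))
      obtain ⟨c', hc', hsep'⟩ := hφ.exists_le_schattenDist_top hp hfin hc hsep
      -- The operator norm bound on the summand `φ n g` passes to the direct sum in the larger
      -- `q`-norm.
      refine ⟨c', hc', hsep'.mono fun n hn =>
        hn.trans ((schattenNorm_antitone hq le_top _).trans ?_)⟩
      rw [← unitaryDirectSum_one]
      exact schattenDist_left_le_unitaryDirectSum _ _ _ _ hq
    · have hg' : (g : Γ ⧸ N) ≠ 1 := fun h => hgN ((QuotientGroup.eq_one_iff g).1 h)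
      obtain ⟨c, hc, hsep⟩ := zero_lt_liminf_ofReal_iff.1 (hψs g hg')
      refine ⟨c, hc, hsep.mono fun n hn => hn.trans ?_⟩
      rw [← unitaryDirectSum_one]
      exact schattenDist_right_le_unitaryDirectSum _ _ _ _ hq

end Approximation

/-! ### Residually finite groups are approximated in every Schatten norm. -/

section ResiduallyFinite

open scoped Matrix.Norms.L2Operator

/-- Permutation matrices, as a homomorphism to the unitary group. -/
def permUnitary (d : ℕ) : Equiv.Perm (Fin d) →* Matrix.unitaryGroup (Fin d) ℂ :=
  (Matrix.permMatrixHom (R := ℂ)).codRestrict (Matrix.unitaryGroup (Fin d) ℂ) fun σ => by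
    rw [Matrix.mem_unitaryGroup_iff, Matrix.star_eq_conjTranspose, Matrix.permMatrixHom_apply,
      Matrix.conjTranspose_permMatrix, ← Matrix.permMatrix_mul]
    simp

theorem one_le_schattenDist_permUnitary {p : ℝ≥0∞} (hp : 1 ≤ p) {d : ℕ} {σ : Equiv.Perm (Fin d)}
    (hσ : σ ≠ 1) : 1 ≤ schattenDist p (permUnitary d σ) 1 := by
  -- The homomorphism `Matrix.permMatrixHom` involves `σ⁻¹`. At a moved point the diagonal entry of
  -- the difference is `-1`, which bounds the operator norm below.
  obtain ⟨i, hi⟩ : ∃ i, σ⁻¹ i ≠ i := by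
    by_contra! h
    exact hσ (inv_eq_one.1 (Equiv.ext h))
  refine le_trans ?_ (schattenNorm_antitone hp le_top _)
  rw [schattenNorm_top]
  refine le_trans (le_of_eq ?_) (Matrix.norm_entry_le_l2_opNorm _ i i)
  have : ((permUnitary d σ : Matrix.unitaryGroup (Fin d) ℂ) : Matrix (Fin d) (Fin d) ℂ) i i = 0 := by
    change (σ⁻¹).permMatrix ℂ i i = 0
    rw [Equiv.Perm.permMatrix, PEquiv.toMatrix_apply, Equiv.toPEquiv_apply]
    simpa using hi
  rw [Matrix.sub_apply, this]
  simp

/-- A finite group acts faithfully by permutations on itself. -/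
theorem exists_injective_hom_perm (G : Type*) [Group G] [Finite G] :
    ∃ (d : ℕ) (f : G →* Equiv.Perm (Fin d)), Function.Injective f :=
  ⟨Nat.card G, ((Finite.equivFin G).permCongrHom.toMonoidHom).comp (MulAction.toPermHom G G),
    (Finite.equivFin G).permCongrHom.injective.comp MulAction.toPerm_injective⟩

theorem Group.ResiduallyFinite.exists_finiteIndexNormalSubgroup_forall_notMem {G : Type*} [Group G]
    [Group.ResiduallyFinite G] (s : Finset G) :
    ∃ H : FiniteIndexNormalSubgroup G, ∀ g ∈ s, g ≠ 1 → g ∉ H := by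
  classical
  induction s using Finset.induction_on with
  | empty => exact ⟨.ofSubgroup ⊤, by simp⟩
  | insert a s _ ih =>
    obtain ⟨H, hH⟩ := ih
    by_cases ha : a = 1
    · refine ⟨H, fun g hg hg1 => ?_⟩
      rcases Finset.mem_insert.1 hg with rfl | hg
      · exact absurd ha hg1
      · exact hH g hg hg1
    · obtain ⟨K, hK⟩ := Group.exists_finiteIndexNormalSubgroup_notMem a ha
      refine ⟨H ⊓ K, fun g hg hg1 hmem => ?_⟩
      have hle1 : H ⊓ K ≤ H := inf_le_left
      have hle2 : H ⊓ K ≤ K := inf_le_right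
      rcases Finset.mem_insert.1 hg with rfl | hg
      · exact hK (hle2 hmem)
      · exact hH g hg hg1 (hle1 hmem)

theorem Group.FG.countable_of_fg (G : Type*) [Group G] [h : Group.FG G] : Countable G := by
  obtain ⟨α, _, f, hf⟩ := Group.fg_iff_exists_freeGroup_hom_surjective_finite.1 h
  exact hf.countable

/-- Enumerate `G` and choose a finite quotient by `H n` that detects the nontrivial elements among
the first `n + 1`. The resulting maps are exact homomorphisms, and each nontrivial element is
eventually at distance at least `1` from the identity. -/
theorem IsSchattenApproximated.of_residuallyFinite {p : ℝ≥0∞} (hp : 1 ≤ p) (G : Type*) [Group G]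
    [Countable G] [Group.ResiduallyFinite G] : IsSchattenApproximated p G := by
  classical
  obtain ⟨e, he⟩ := exists_surjective_nat G
  choose H hH using fun n =>
    Group.ResiduallyFinite.exists_finiteIndexNormalSubgroup_forall_notMem
      ((Finset.range (n + 1)).image e)
  choose d f hf using fun n => exists_injective_hom_perm (G ⧸ (H n).toSubgroup)
  refine ⟨d, fun n g => permUnitary (d n) (f n (g : G ⧸ (H n).toSubgroup)), fun g h => ?_,
    fun g hg => ?_⟩
  · refine tendsto_const_nhds.congr fun n => ?_
    beta_reduce
    rw [QuotientGroup.mk_mul, map_mul, map_mul, schattenDist_self hp]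
  · rw [zero_lt_liminf_ofReal_iff]
    obtain ⟨k, rfl⟩ := he g
    refine ⟨1, one_pos, ?_⟩
    filter_upwards [eventually_ge_atTop k] with n hn
    refine one_le_schattenDist_permUnitary hp fun h => ?_
    rw [← map_one (f n)] at h
    exact hH n (e k) (Finset.mem_image_of_mem e (by simpa using Nat.lt_succ_of_le hn)) hg
      ((QuotientGroup.eq_one_iff _).1 (hf n h))

end ResiduallyFinite

theorem mainTheorem5 {Γ : Type*} [Group Γ] [Group.FG Γ] (N : Subgroup Γ) [N.Normal] [Finite N] :
    (∀ p q : ℝ≥0∞, 1 ≤ p → p ≤ q → IsSchattenApproximated q (Γ ⧸ N) →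
      IsSchattenApproximated p Γ → IsSchattenApproximated q Γ) ∧
    (Group.ResiduallyFinite (Γ ⧸ N) →
      ∀ p q : ℝ≥0∞, 1 ≤ p → p ≤ q →
        IsSchattenApproximated p Γ → IsSchattenApproximated q Γ) := by
  refine ⟨fun p q hp hpq hN hΓ => IsSchattenApproximated.of_quotient_finite N hp hpq hN hΓ,
    fun hN p q hp hpq hΓ => ?_⟩
  -- Countability lets a sequence of finite quotients detect every nontrivial element of `Γ ⧸ N`.
  have := Group.FG.countable_of_fg Γ
  have : Countable (Γ ⧸ N) := (QuotientGroup.mk_surjective (s := N)).countable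
  exact IsSchattenApproximated.of_quotient_finite N hp hpq
    (.of_residuallyFinite (hp.trans hpq) (Γ ⧸ N)) hΓ
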